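/- Let $0<R_1<R_2\le 3R_1$. Let node 1 and node 2 be independent random points of the Euclidean plane, node 2 being uniformly distributed in the annulus $\{x : R_1\le\|x\|\le R_2\}$. Assume one of the following two scenarios for node 1. * ($s_1$) Node 1 is uniformly distributed in the disk $\{x:\|x\|\le R_1\}$. * ($s_2$) Node 1 follows the random waypoint (RWP) stationary distribution in this disk, taken to be a distribution for which the distance $\rho$ of node 1 from the centre has the density $f(\rho)=\frac{4\rho}{R_1^2}\bigl(1-\frac{\rho^2}{R_1^2}\bigr)$ for $0\le\rho\le R_1$ and $f(\rho)=0$ otherwise. Put $S=\pi(R_2^2-R_1^2)$, $k(r)=\sqrt{(r^2-(R_2-R_1)^2)((R_1+R_2)^2-r^2)}$, and $$\phi_0(r)=\arccos\frac{r}{2R_1},\qquad \phi_1(r)=\arccos\frac{R_2^2+r^2-R_1^2}{2rR_2},\qquad \phi_2(r)=\arccos\frac{R_1^2+r^2-R_2^2}{2rR_1}.$$ Then the distance $r$ between node 1 and node 2 has, with respect to Lebesgue measure, the (everywhere nonnegative) probability density function $$f_{\mathbf r}(r)=\begin{cases} \dfrac{2r}{SR_1}\bigl(\pi R_1+q_1(r)\sin\phi_0(r)+q_2(r)\phi_0(r)\bigr),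 & 0\le r\le R_2-R_1,\\[2mm] \dfrac{2r}{SR_1^2}\bigl(q_3(r)\sin\phi_0(r)+q_4(r)\phi_0(r)+q_5(r)\sin\phi_1(r)+q_6(r)\phi_1(r)+q_7(r)\phi_2(r)+q_8(r)k(r)\bigr), & R_2-R_1<r\le 2R_1,\\[2mm] \dfrac{2r}{SR_1^2}\bigl(q_9(r)\sin\phi_1(r)+q_{10}(r)\phi_1(r)+q_{11}(r)\phi_2(r)+q_{12}(r)k(r)\bigr), & 2R_1<r\le R_1+R_2,\\[2mm] 0, & \text{otherwise,} \end{cases}$$ where in scenario $s_1$ $$q_1=r,\quad q_2=-2R_1,\quad q_3=rR_1,\quad q_4=-2R_1^2,\quad q_5=q_9=-rR_2,\quad q_6=q_{10}=R_2^2,\quad q_7=q_{11}=R_1^2,\quad q_8=q_{12}=0,$$ and in scenario $s_2$ $$q_1=-\frac{r(2R_1^2+r^2)}{2R_1^2},\quad q_2=-\frac{2(R_1^2-r^2)}{R_1},\quad q_3=-\frac{r(2R_1^2+r^2)}{2R_1},\quad q_4=-2(R_1^2-r^2),\quad q_5=q_9=0,$$ $$q_6=q_{10}=-\frac{R_2^2(2r^2-2R_1^2+R_2^2)}{R_1^2},\quad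 q_7=q_{11}=R_1^2,\quad q_8=q_{12}=\frac{r^2-3R_1^2+5R_2^2}{4R_1^2}.$$ -/

import Mathlib

open MeasureTheory ProbabilityTheory

noncomputable section

namespace DiskAnnulus

/-- The Euclidean plane. -/
abbrev Plane : Type := EuclideanSpace ℝ (Fin 2)

/-- The disk of radius `R₁` centred at the origin. -/
def disk (R₁ : ℝ) : Set Plane := {x | ‖x‖ ≤ R₁}

/-- The concentric annulus with radii `R₁` and `R₂`. -/
def annulus (R₁ R₂ : ℝ) : Set Plane := {x | R₁ ≤ ‖x‖ ∧ ‖x‖ ≤ R₂}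

/-- The real random variable `X` has probability density function `f` with respect to
Lebesgue measure; `f` is required to be nonnegative everywhere. -/
def HasDensity {Ω : Type*} [MeasurableSpace Ω] (P : Measure Ω) (X : Ω → ℝ) (f : ℝ → ℝ) : Prop :=
  HasPDF X P volume ∧ (∀ x, 0 ≤ f x) ∧
    pdf X P volume =ᵐ[volume] fun x => ENNReal.ofReal (f x)

/-- The two scenarios: node 1 static (uniform in the disk), or node 1 mobile
(random waypoint stationary distribution in the disk). -/
inductive Scenario
  | s₁
  | s₂

/-- The density of the distance from the centre of a node following the random waypoint
stationary distribution in the disk of radius `R₁`. -/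
def rwpRadialDensity (R₁ ρ : ℝ) : ℝ :=
  if 0 ≤ ρ ∧ ρ ≤ R₁ then 4 * ρ / R₁ ^ 2 * (1 - ρ ^ 2 / R₁ ^ 2) else 0

/-- The distributional assumption on the position of node 1 in each scenario. In scenario `s₂`
only the distance from the centre is prescribed; no isotropy of the position is needed. -/
def Node1Law {Ω : Type*} [MeasurableSpace Ω] (P : Measure Ω) (X₁ : Ω → Plane) (R₁ : ℝ) :
    Scenario → Prop
  | .s₁ => pdf.IsUniform X₁ (disk R₁) P volume
  | .s₂ => HasDensity P (fun ω => ‖X₁ ω‖) (rwpRadialDensity R₁)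

/-- The area of the annulus. -/
def S (R₁ R₂ : ℝ) : ℝ := Real.pi * (R₂ ^ 2 - R₁ ^ 2)

def θ₁ (R₁ ρ r : ℝ) : ℝ := Real.arccos ((ρ ^ 2 + r ^ 2 - R₁ ^ 2) / (2 * r * ρ))

def θ₂ (R₂ ρ r : ℝ) : ℝ := Real.arccos ((ρ ^ 2 + r ^ 2 - R₂ ^ 2) / (2 * r * ρ))

def φ₀ (R₁ r : ℝ) : ℝ := θ₁ R₁ R₁ r

def φ₁ (R₁ R₂ r : ℝ) : ℝ := θ₁ R₁ R₂ r

def φ₂ (R₁ R₂ r : ℝ) : ℝ := θ₂ R₂ R₁ r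

def k (R₁ R₂ r : ℝ) : ℝ :=
  Real.sqrt ((r ^ 2 - (R₂ - R₁) ^ 2) * ((R₁ + R₂) ^ 2 - r ^ 2))

def q₁ (R₁ r : ℝ) : Scenario → ℝ
  | .s₁ => r
  | .s₂ => -(r * (2 * R₁ ^ 2 + r ^ 2) / (2 * R₁ ^ 2))

def q₂ (R₁ r : ℝ) : Scenario → ℝ
  | .s₁ => -2 * R₁
  | .s₂ => -(2 * (R₁ ^ 2 - r ^ 2) / R₁)

def q₃ (R₁ r : ℝ) : Scenario → ℝ
  | .s₁ => r * R₁
  | .s₂ => -(r * (2 * R₁ ^ 2 + r ^ 2) / (2 * R₁))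

def q₄ (R₁ r : ℝ) : Scenario → ℝ
  | .s₁ => -2 * R₁ ^ 2
  | .s₂ => -2 * (R₁ ^ 2 - r ^ 2)

def q₅ (R₂ r : ℝ) : Scenario → ℝ
  | .s₁ => -(r * R₂)
  | .s₂ => 0

def q₆ (R₁ R₂ r : ℝ) : Scenario → ℝ
  | .s₁ => R₂ ^ 2
  | .s₂ => -(R₂ ^ 2 * (2 * r ^ 2 - 2 * R₁ ^ 2 + R₂ ^ 2) / R₁ ^ 2)

def q₇ (R₁ : ℝ) : Scenario → ℝ
  | .s₁ => R₁ ^ 2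
  | .s₂ => R₁ ^ 2

def q₈ (R₁ R₂ r : ℝ) : Scenario → ℝ
  | .s₁ => 0
  | .s₂ => (r ^ 2 - 3 * R₁ ^ 2 + 5 * R₂ ^ 2) / (4 * R₁ ^ 2)

def q₉ (R₂ r : ℝ) (s : Scenario) : ℝ := q₅ R₂ r s

def q₁₀ (R₁ R₂ r : ℝ) (s : Scenario) : ℝ := q₆ R₁ R₂ r s

def q₁₁ (R₁ : ℝ) (s : Scenario) : ℝ := q₇ R₁ s

def q₁₂ (R₁ R₂ r : ℝ) (s : Scenario) : ℝ := q₈ R₁ R₂ r s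

/-- The closed-form density of the internodal distance, for `R₁ < R₂ ≤ 3 R₁`. -/
def distanceDensity (R₁ R₂ : ℝ) (s : Scenario) (r : ℝ) : ℝ :=
  if 0 ≤ r ∧ r ≤ R₂ - R₁ then
    2 * r / (S R₁ R₂ * R₁) *
      (Real.pi * R₁ + q₁ R₁ r s * Real.sin (φ₀ R₁ r) + q₂ R₁ r s * φ₀ R₁ r)
  else if R₂ - R₁ < r ∧ r ≤ 2 * R₁ then
    2 * r / (S R₁ R₂ * R₁ ^ 2) *
      (q₃ R₁ r s * Real.sin (φ₀ R₁ r) + q₄ R₁ r s * φ₀ R₁ r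
        + q₅ R₂ r s * Real.sin (φ₁ R₁ R₂ r) + q₆ R₁ R₂ r s * φ₁ R₁ R₂ r
        + q₇ R₁ s * φ₂ R₁ R₂ r + q₈ R₁ R₂ r s * k R₁ R₂ r)
  else if 2 * R₁ < r ∧ r ≤ R₁ + R₂ then
    2 * r / (S R₁ R₂ * R₁ ^ 2) *
      (q₉ R₂ r s * Real.sin (φ₁ R₁ R₂ r) + q₁₀ R₁ R₂ r s * φ₁ R₁ R₂ r
        + q₁₁ R₁ s * φ₂ R₁ R₂ r + q₁₂ R₁ R₂ r s * k R₁ R₂ r)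
  else 0

end DiskAnnulus

end

/-!
If node 1 is at distance `ρ > 0` from the centre, the points at distance `r` from it form a circle,
and the law of cosines says that the part of this circle inside the disk of radius `R` has
half-angle `halfAngle R ρ r = arccos ((ρ² + r² - R²) / (2rρ))`, where the clamping of `arccos` to
`0` and `π` takes care of circles that miss the disk or lie inside it. So, by polar coordinates
around node 1 (`setLIntegral_annulus_dist`), the distance to node 2 has the conditional density
`(2r / S) (halfAngle R₂ ρ r - halfAngle R₁ ρ r)`. It depends on node 1 only through `ρ`, whose
density is known in both scenarios (`map_norm_eq_withDensity`), and Tonelli's theorem turns the law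
of the distance into the average of this conditional density over `ρ`
(`map_dist_eq_withDensity`).

The average is a combination of the integrals of `2ρ · halfAngle R ρ r` and `4ρ³ · halfAngle R ρ r`
over `[0, a]`. Both have elementary primitives built from the angles of the triangle with sides
`ρ`, `r`, `R` and from `k`, which is four times its area: see `integral_mul_halfAngle` and
`integral_cube_mul_halfAngle`. With `Real.arccos` and `Real.sqrt` extended by constants these
primitives are continuous and remain valid when there is no such triangle, so a single formula
(`integral_radialDensity_mul`) covers every `r > 0`; the pieces of the density arise from it by
inserting the extreme values of the angles. Nonnegativity is clear from the integral.
-/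

/-! ### Moments of the half-angle of a circular arc inside a disk -/

namespace DiskAnnulus

/-- Half of the angle of the arc which the disk of radius `R` centred at the origin cuts out of a
circle of radius `r` whose centre is at distance `ρ` from the origin. As `Real.arccos` is constant
on each side of `[-1, 1]`, the value is `0` when the circle lies outside the disk and `π` when it
lies inside. For `ρ = 0` or `r = 0` it is the junk value `arccos 0`. -/
noncomputable def halfAngle (R ρ r : ℝ) : ℝ := Real.arccos ((ρ ^ 2 + r ^ 2 - R ^ 2) / (2 * r * ρ))

lemma halfAngle_nonneg (R ρ r : ℝ) : 0 ≤ halfAngle R ρ r := Real.arccos_nonneg _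

lemma halfAngle_le_pi (R ρ r : ℝ) : halfAngle R ρ r ≤ Real.pi := Real.arccos_le_pi _

lemma halfAngle_mono {R R' ρ r : ℝ} (hR : 0 ≤ R) (hRR' : R ≤ R') (hρ : 0 ≤ ρ) (hr : 0 ≤ r) :
    halfAngle R ρ r ≤ halfAngle R' ρ r := by
  refine Real.arccos_le_arccos ?_
  gcongr

lemma halfAngle_eq_zero {R ρ r : ℝ} (hρ : 0 < ρ) (hr : 0 < r) (h : R ^ 2 ≤ (ρ - r) ^ 2) :
    halfAngle R ρ r = 0 := by
  rw [halfAngle, Real.arccos_eq_zero, one_le_div (by positivity)]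
  linarith

lemma halfAngle_eq_pi {R ρ r : ℝ} (hρ : 0 < ρ) (hr : 0 < r) (h : (ρ + r) ^ 2 ≤ R ^ 2) :
    halfAngle R ρ r = Real.pi := by
  rw [halfAngle, Real.arccos_eq_pi, div_le_iff₀ (by positivity)]
  linarith

lemma sqrt_one_sub_sq_cos_halfAngle {R ρ r : ℝ} (hρ : 0 < ρ) (hr : 0 < r) :
    √(1 - ((ρ ^ 2 + r ^ 2 - R ^ 2) / (2 * r * ρ)) ^ 2) = k R ρ r / (2 * r * ρ) := by
  have h : 1 - ((ρ ^ 2 + r ^ 2 - R ^ 2) / (2 * r * ρ)) ^ 2 =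
      (r ^ 2 - (ρ - R) ^ 2) * ((R + ρ) ^ 2 - r ^ 2) / (2 * r * ρ) ^ 2 := by
    field_simp
    ring
  rw [h, Real.sqrt_div' _ (sq_nonneg _), Real.sqrt_sq (by positivity), k]

lemma sin_halfAngle {R ρ r : ℝ} (hρ : 0 < ρ) (hr : 0 < r) :
    Real.sin (halfAngle R ρ r) = k R ρ r / (2 * r * ρ) := by
  rw [halfAngle, Real.sin_arccos, sqrt_one_sub_sq_cos_halfAngle hρ hr]

lemma k_comm (R ρ r : ℝ) : k R ρ r = k ρ R r := by
  simp only [k]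
  congr 1
  ring

/-- When there is no nondegenerate triangle with sides `ρ`, `r`, `R`, the angle is locally constant
in `ρ`; the formula then gives `0`, because it divides by `k R ρ r = 0`. The same remark applies to
the next two lemmas. -/
lemma hasDerivAt_halfAngle_center {R ρ r : ℝ} (hρ : 0 < ρ) (hr : 0 < r)
    (h : (r ^ 2 - (ρ - R) ^ 2) * ((R + ρ) ^ 2 - r ^ 2) ≠ 0) :
    HasDerivAt (fun x => halfAngle R x r) (-((ρ ^ 2 + R ^ 2 - r ^ 2) / (ρ * k R ρ r))) ρ := by
  have hu : HasDerivAt (fun x => (x ^ 2 + r ^ 2 - R ^ 2) / (2 * r * x))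
      ((ρ ^ 2 + R ^ 2 - r ^ 2) / (2 * r * ρ ^ 2)) ρ := by
    have := (((hasDerivAt_id ρ).pow 2).add_const (r ^ 2) |>.sub_const (R ^ 2)).div
      ((hasDerivAt_id ρ).const_mul (2 * r)) (by simp; constructor <;> positivity)
    refine this.congr_deriv ?_
    simp
    field_simp
    ring
  have hne : ∀ c : ℝ, c ^ 2 = 1 → (ρ ^ 2 + r ^ 2 - R ^ 2) / (2 * r * ρ) ≠ c := by
    intro c hc h'
    rw [div_eq_iff (by positivity)] at h'
    apply h
    have : (ρ ^ 2 + r ^ 2 - R ^ 2) ^ 2 = (2 * r * ρ) ^ 2 := by rw [h', mul_pow, hc, one_mul]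
    linear_combination -this
  have := (Real.hasDerivAt_arccos (hne (-1) (by norm_num)) (hne 1 (by norm_num))).comp ρ hu
  refine this.congr_deriv ?_
  rw [sqrt_one_sub_sq_cos_halfAngle hρ hr]
  rcases eq_or_ne (k R ρ r) 0 with hk | hk
  · simp [hk]
  · field_simp

lemma hasDerivAt_halfAngle_radius {R ρ r : ℝ} (hR : 0 < R) (hr : 0 < r)
    (h : (r ^ 2 - (ρ - R) ^ 2) * ((R + ρ) ^ 2 - r ^ 2) ≠ 0) :
    HasDerivAt (fun x => halfAngle x R r) (2 * ρ / k R ρ r) ρ := by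
  have hu : HasDerivAt (fun x => (R ^ 2 + r ^ 2 - x ^ 2) / (2 * r * R))
      (-(2 * ρ) / (2 * r * R)) ρ := by
    refine ((((hasDerivAt_id ρ).pow 2).const_sub (R ^ 2 + r ^ 2)).div_const
      (2 * r * R)).congr_deriv ?_
    simp
  have hne : ∀ c : ℝ, c ^ 2 = 1 → (R ^ 2 + r ^ 2 - ρ ^ 2) / (2 * r * R) ≠ c := by
    intro c hc h'
    rw [div_eq_iff (by positivity)] at h'
    apply h
    have : (R ^ 2 + r ^ 2 - ρ ^ 2) ^ 2 = (2 * r * R) ^ 2 := by rw [h', mul_pow, hc, one_mul]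
    linear_combination -this
  have := (Real.hasDerivAt_arccos (hne (-1) (by norm_num)) (hne 1 (by norm_num))).comp ρ hu
  refine this.congr_deriv ?_
  rw [sqrt_one_sub_sq_cos_halfAngle hR hr, k_comm]
  rcases eq_or_ne (k R ρ r) 0 with hk | hk
  · simp [hk]
  · field_simp

lemma hasDerivAt_k {R ρ r : ℝ}
    (h : (r ^ 2 - (ρ - R) ^ 2) * ((R + ρ) ^ 2 - r ^ 2) ≠ 0) :
    HasDerivAt (fun x => k R x r) (2 * ρ * (r ^ 2 + R ^ 2 - ρ ^ 2) / k R ρ r) ρ := by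
  have h1 : HasDerivAt (fun x => r ^ 2 - (x - R) ^ 2) (-(2 * (ρ - R))) ρ := by
    refine ((((hasDerivAt_id ρ).sub_const R).pow 2).const_sub (r ^ 2)).congr_deriv ?_
    simp
  have h2 : HasDerivAt (fun x => (R + x) ^ 2 - r ^ 2) (2 * (R + ρ)) ρ := by
    refine ((((hasDerivAt_id ρ).const_add R).pow 2).sub_const (r ^ 2)).congr_deriv ?_
    simp
  refine ((h1.mul h2).sqrt h).congr_deriv ?_
  rw [k]
  simp only [Pi.mul_apply]
  rw [← div_div]
  congr 1
  ring

/-- The factor `ρ` removes the discontinuity of `halfAngle R · r` at `0`. -/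
lemma continuous_mul_halfAngle (R : ℝ) {r : ℝ} (hr : 0 < r) :
    Continuous fun ρ => ρ * halfAngle R ρ r := by
  refine continuous_iff_continuousAt.2 fun ρ => ?_
  rcases eq_or_ne ρ 0 with rfl | hρ
  · have h : Filter.Tendsto (fun ρ : ℝ => |ρ| * Real.pi) (nhds 0) (nhds 0) := by
      have : Continuous fun ρ : ℝ => |ρ| * Real.pi := by fun_prop
      simpa using this.tendsto 0
    simp only [ContinuousAt, zero_mul]
    refine squeeze_zero_norm (fun ρ => ?_) h
    rw [norm_mul, Real.norm_eq_abs, Real.norm_eq_abs, abs_of_nonneg (halfAngle_nonneg _ _ _)]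
    exact mul_le_mul_of_nonneg_left (halfAngle_le_pi _ _ _) (abs_nonneg _)
  · unfold halfAngle
    refine continuousAt_id.mul (Real.continuous_arccos.continuousAt.comp ?_)
    refine ContinuousAt.div (by fun_prop) (by fun_prop) ?_
    simp [hr.ne', hρ]

lemma continuous_halfAngle_radius (R r : ℝ) : Continuous fun ρ => halfAngle ρ R r := by
  unfold halfAngle
  exact Real.continuous_arccos.comp (by fun_prop)

lemma continuous_k (R r : ℝ) : Continuous fun ρ => k R ρ r := by
  unfold k
  fun_prop

/-- The degenerate positions, in which the circle is tangent to the boundary of the disk. -/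
lemma mem_of_tangent {R ρ r : ℝ} (hR : 0 < R) (hρ : 0 < ρ) (hr : 0 < r)
    (h : (r ^ 2 - (ρ - R) ^ 2) * ((R + ρ) ^ 2 - r ^ 2) = 0) :
    ρ ∈ ({R - r, R + r, r - R} : Set ℝ) := by
  have h' : (ρ - (R - r)) * (ρ - (R + r)) * (ρ - (r - R)) = 0 := by
    have hp : R + ρ + r ≠ 0 := by positivity
    refine (mul_eq_zero.1 (?_ : (R + ρ + r) * _ = 0)).resolve_left hp
    linear_combination -h
  simp only [mul_eq_zero, sub_eq_zero] at h'
  simp only [Set.mem_insert_iff, Set.mem_singleton_iff]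
  tauto

lemma halfAngle_zero_left {R r : ℝ} (hR : 0 < R) (hr : 0 < r) : halfAngle 0 R r = 0 :=
  halfAngle_eq_zero hR hr (by simpa using sq_nonneg (R - r))

lemma k_zero_right (R r : ℝ) : k R 0 r = 0 := by
  rw [k]
  refine Real.sqrt_eq_zero_of_nonpos ?_
  nlinarith [sq_nonneg (r ^ 2 - R ^ 2)]

/-- The tangent positions, where `arccos` and `√` are not differentiable, are finite in number and
do not affect the fundamental theorem of calculus. -/
lemma integral_eq_sub_of_hasDerivAt_off_tangent {R r a : ℝ} (hR : 0 < R) (hr : 0 < r)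
    (ha : 0 ≤ a) {F f : ℝ → ℝ} (hF : Continuous F) (hf : Continuous f)
    (hd : ∀ ρ, 0 < ρ → (r ^ 2 - (ρ - R) ^ 2) * ((R + ρ) ^ 2 - r ^ 2) ≠ 0 →
      HasDerivAt F (f ρ) ρ) :
    ∫ ρ in (0)..a, f ρ = F a - F 0 := by
  refine integral_eq_of_hasDerivAt_off_countable_of_le F f ha
    (s := {R - r, R + r, r - R}) (Set.toFinite _).countable hF.continuousOn
    (fun ρ hρ => hd ρ hρ.1.1 fun h => hρ.2 (mem_of_tangent hR hρ.1.1 hr h))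
    (hf.intervalIntegrable _ _)

lemma integral_mul_halfAngle {R r a : ℝ} (hR : 0 < R) (hr : 0 < r) (ha : 0 ≤ a) :
    ∫ ρ in (0)..a, 2 * (ρ * halfAngle R ρ r) =
      a ^ 2 * halfAngle R a r + R ^ 2 * halfAngle a R r - k R a r / 2 := by
  have hc := continuous_mul_halfAngle R hr
  have hF : Continuous fun ρ =>
      ρ ^ 2 * halfAngle R ρ r + R ^ 2 * halfAngle ρ R r - k R ρ r / 2 := by
    have h2 : (fun ρ => ρ ^ 2 * halfAngle R ρ r) = fun ρ => ρ * (ρ * halfAngle R ρ r) := by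
      ext; ring
    have h3 : Continuous fun ρ => ρ ^ 2 * halfAngle R ρ r := h2 ▸ continuous_id.fun_mul hc
    refine (h3.add ((continuous_halfAngle_radius R r).const_mul _)).sub ((continuous_k R r).div_const 2)
  rw [integral_eq_sub_of_hasDerivAt_off_tangent hR hr ha hF (hc.const_mul 2)]
  · simp [halfAngle_zero_left hR hr, k_zero_right]
  · intro ρ hρ h
    refine ((((hasDerivAt_pow 2 ρ).mul (hasDerivAt_halfAngle_center hρ hr h)).add
      ((hasDerivAt_halfAngle_radius hR hr h).const_mul (R ^ 2))).sub
      ((hasDerivAt_k h).div_const 2)).congr_deriv ?_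
    rcases eq_or_ne (k R ρ r) 0 with hk | hk
    · simp [hk]
      ring
    · field_simp
      ring

lemma integral_cube_mul_halfAngle {R r a : ℝ} (hR : 0 < R) (hr : 0 < r) (ha : 0 ≤ a) :
    ∫ ρ in (0)..a, 4 * (ρ ^ 2 * (ρ * halfAngle R ρ r)) =
      a ^ 4 * halfAngle R a r + R ^ 2 * (R ^ 2 + 2 * r ^ 2) * halfAngle a R r
        - (a ^ 2 + 5 * R ^ 2 + r ^ 2) * k R a r / 4 := by
  have hc := continuous_mul_halfAngle R hr
  have hF : Continuous fun ρ =>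
      ρ ^ 4 * halfAngle R ρ r + R ^ 2 * (R ^ 2 + 2 * r ^ 2) * halfAngle ρ R r
        - (ρ ^ 2 + 5 * R ^ 2 + r ^ 2) * k R ρ r / 4 := by
    have h2 : (fun ρ => ρ ^ 4 * halfAngle R ρ r) = fun ρ => ρ ^ 3 * (ρ * halfAngle R ρ r) := by
      ext; ring
    have h3 : Continuous fun ρ => ρ ^ 4 * halfAngle R ρ r := h2 ▸ (continuous_pow 3).fun_mul hc
    refine (h3.add ((continuous_halfAngle_radius R r).const_mul _)).sub
      ((Continuous.mul (by fun_prop) (continuous_k R r)).div_const 4)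
  rw [integral_eq_sub_of_hasDerivAt_off_tangent hR hr ha hF
    (((continuous_pow 2).fun_mul hc).const_mul 4)]
  · simp [halfAngle_zero_left hR hr, k_zero_right]
  · intro ρ hρ h
    have hp : HasDerivAt (fun ρ : ℝ => ρ ^ 2 + 5 * R ^ 2 + r ^ 2) (2 * ρ) ρ := by
      refine (((hasDerivAt_pow 2 ρ).add_const (5 * R ^ 2)).add_const (r ^ 2)).congr_deriv ?_
      simp
    refine ((((hasDerivAt_pow 4 ρ).mul (hasDerivAt_halfAngle_center hρ hr h)).add
      ((hasDerivAt_halfAngle_radius hR hr h).const_mul (R ^ 2 * (R ^ 2 + 2 * r ^ 2)))).sub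
      ((hp.mul (hasDerivAt_k h)).div_const 4)).congr_deriv ?_
    rcases eq_or_ne (k R ρ r) 0 with hk | hk
    · simp [hk]
      ring
    · have hk2 : k R ρ r ^ 2 = (r ^ 2 - (ρ - R) ^ 2) * ((R + ρ) ^ 2 - r ^ 2) := by
        refine Real.sq_sqrt (le_of_lt ?_)
        contrapose! hk
        exact Real.sqrt_eq_zero_of_nonpos hk
      field_simp
      simp only [hk2]
      ring

/-! ### Integration in polar coordinates around a point of the plane -/

open Set in
/-- The angles at which a circle of radius `r`, whose centre has distance `ρ` from the origin, runs
through the annulus. -/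
lemma volume_angles_annulus {R₁ R₂ ρ r : ℝ} (hR₁ : 0 ≤ R₁) (hR₁₂ : R₁ ≤ R₂) (hρ : 0 < ρ)
    (hr : 0 < r) :
    volume ({θ : ℝ | R₁ ^ 2 ≤ ρ ^ 2 + r ^ 2 - 2 * r * ρ * Real.cos θ ∧
        ρ ^ 2 + r ^ 2 - 2 * r * ρ * Real.cos θ ≤ R₂ ^ 2} ∩ Ioo (-Real.pi) Real.pi) =
      ENNReal.ofReal (2 * (halfAngle R₂ ρ r - halfAngle R₁ ρ r)) := by
  set b₁ := halfAngle R₁ ρ r with hb₁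
  set b₂ := halfAngle R₂ ρ r with hb₂
  have h0 : 0 ≤ b₁ := halfAngle_nonneg _ _ _
  have hπ : b₂ ≤ Real.pi := halfAngle_le_pi _ _ _
  have hle : b₁ ≤ b₂ := halfAngle_mono hR₁ hR₁₂ hρ.le hr.le
  have hp : 0 < 2 * r * ρ := by positivity
  have hcos : ∀ θ : ℝ, |θ| < Real.pi → Real.arccos (Real.cos θ) = |θ| := fun θ hθ => by
    rw [← Real.cos_abs, Real.arccos_cos (abs_nonneg _) hθ.le]
  have heq : ({θ : ℝ | R₁ ^ 2 ≤ ρ ^ 2 + r ^ 2 - 2 * r * ρ * Real.cos θ ∧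
        ρ ^ 2 + r ^ 2 - 2 * r * ρ * Real.cos θ ≤ R₂ ^ 2} ∩ Ioo (-Real.pi) Real.pi : Set ℝ) =ᵐ[volume]
      ((Icc (-b₂) b₂ \ Ioo (-b₁) b₁) ∩ Ioo (-Real.pi) Real.pi : Set ℝ) := by
    -- At `θ = 0` the equality fails if the circle lies outside the disk of radius `R₂`.
    filter_upwards [(countable_singleton (0 : ℝ)).ae_notMem volume] with θ hθ0
    refine propext (?_ : θ ∈ (_ : Set ℝ) ↔ θ ∈ (_ : Set ℝ))
    simp only [mem_ofPred_eq, mem_sdiff, ← abs_le, mem_Icc, mem_Ioo, ← abs_lt,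
      not_lt]
    refine and_congr_left fun hθ => ?_
    -- On `(-π, π)` both inequalities compare `|θ| = arccos (cos θ)` with a half-angle.
    have h₁ : R₁ ^ 2 ≤ ρ ^ 2 + r ^ 2 - 2 * r * ρ * Real.cos θ ↔ b₁ ≤ |θ| := by
      rw [← hcos θ hθ]
      constructor
      · intro h
        refine Real.arccos_le_arccos ?_
        rw [le_div_iff₀ hp]
        linarith
      · intro h
        by_contra! hlt
        have hlt' : (ρ ^ 2 + r ^ 2 - R₁ ^ 2) / (2 * r * ρ) < Real.cos θ := by
          rw [div_lt_iff₀ hp]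
          linarith
        rcases lt_or_ge ((ρ ^ 2 + r ^ 2 - R₁ ^ 2) / (2 * r * ρ)) (-1) with hm | hm
        · rw [hb₁, halfAngle, Real.arccos_of_le_neg_one hm.le, hcos θ hθ] at h
          linarith
        · have := Real.strictAntiOn_arccos ⟨hm, hlt'.le.trans (Real.cos_le_one _)⟩
            ⟨Real.neg_one_le_cos _, Real.cos_le_one _⟩ hlt'
          exact absurd h (not_le.2 this)
    have h₂ : ρ ^ 2 + r ^ 2 - 2 * r * ρ * Real.cos θ ≤ R₂ ^ 2 ↔ |θ| ≤ b₂ := by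
      rw [← hcos θ hθ]
      constructor
      · intro h
        refine Real.arccos_le_arccos ?_
        rw [div_le_iff₀ hp]
        linarith
      · intro h
        by_contra! hlt
        have hlt' : Real.cos θ < (ρ ^ 2 + r ^ 2 - R₂ ^ 2) / (2 * r * ρ) := by
          rw [lt_div_iff₀ hp]
          linarith
        rcases lt_or_ge 1 ((ρ ^ 2 + r ^ 2 - R₂ ^ 2) / (2 * r * ρ)) with hm | hm
        · rw [hb₂, halfAngle, Real.arccos_of_one_le hm.le, hcos θ hθ] at h
          exact hθ0 (abs_nonpos_iff.1 h)
        · have := Real.strictAntiOn_arccos ⟨Real.neg_one_le_cos _, Real.cos_le_one _⟩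
            ⟨(Real.neg_one_le_cos _).trans hlt'.le, hm⟩ hlt'
          exact absurd h (not_le.2 this)
    rw [h₁, h₂, and_comm]
  have hae : ((Icc (-b₂) b₂ \ Ioo (-b₁) b₁) ∩ Ioo (-Real.pi) Real.pi : Set ℝ) =ᵐ[volume]
      (Icc (-b₂) b₂ \ Ioo (-b₁) b₁ : Set ℝ) := by
    refine (ae_eq_refl _).inter Ioo_ae_eq_Icc |>.trans (Filter.EventuallyEq.of_eq ?_)
    exact inter_eq_left.2 (sdiff_subset.trans (Icc_subset_Icc (neg_le_neg hπ) hπ))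
  rw [measure_congr heq, measure_congr hae, measure_sdiff (Ioo_subset_Icc_self.trans
    (Icc_subset_Icc (neg_le_neg hle) hle)) measurableSet_Ioo.nullMeasurableSet (by simp),
    Real.volume_Icc, Real.volume_Ioo, ← ENNReal.ofReal_sub _ (by linarith)]
  congr 1
  ring

/-- Polar coordinates around `x`, with the angle measured from the direction of the origin. -/
lemma lintegral_norm_dist_eq_polar (x : Plane) {G : ℝ → ℝ → ENNReal}
    (hG : Measurable (Function.uncurry G)) :
    ∫⁻ y, G ‖y‖ (dist x y) =
      ∫⁻ r in Set.Ioi (0 : ℝ), ENNReal.ofReal r * ∫⁻ θ in Set.Ioo (-Real.pi) Real.pi,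
        G (√(‖x‖ ^ 2 + r ^ 2 - 2 * r * ‖x‖ * Real.cos θ)) r := by
  obtain ⟨L, hL⟩ : ∃ L : Plane ≃ₗᵢ[ℝ] ℂ, L x = (‖x‖ : ℂ) := by
    set e : Plane ≃ₗᵢ[ℝ] ℂ := Complex.orthonormalBasisOneI.repr.symm with he
    refine ⟨e.trans (rotation (Circle.exp (-(e x).arg))), ?_⟩
    have h := Complex.norm_mul_exp_arg_mul_I (e x)
    rw [LinearIsometryEquiv.norm_map] at h
    rw [LinearIsometryEquiv.trans_apply, rotation_apply, Circle.coe_exp]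
    nth_rw 2 [← h]
    rw [mul_left_comm, ← Complex.exp_add]
    simp
  have hshift : ∫⁻ y, G ‖y‖ (dist x y) = ∫⁻ v : Plane, G ‖x - v‖ ‖v‖ := by
    rw [← lintegral_sub_left_eq_self _ x]
    simp
  have hrot : ∫⁻ v : Plane, G ‖x - v‖ ‖v‖ = ∫⁻ z : ℂ, G ‖(‖x‖ : ℂ) - z‖ ‖z‖ := by
    rw [← L.measurePreserving.lintegral_comp (f := fun z => G ‖(‖x‖ : ℂ) - z‖ ‖z‖)]
    · simp_rw [← hL, ← map_sub, LinearIsometryEquiv.norm_map]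
    · exact hG.comp (f := fun z : ℂ => (‖(‖x‖ : ℂ) - z‖, ‖z‖)) (by fun_prop)
  rw [hshift, hrot, ← Complex.lintegral_comp_polarCoord_symm, polarCoord_target,
    Measure.volume_eq_prod, ← Measure.prod_restrict, lintegral_prod]
  · refine setLIntegral_congr_fun measurableSet_Ioi fun r hr => ?_
    simp only [smul_eq_mul]
    rw [lintegral_const_mul]
    · congr 1
      refine lintegral_congr fun θ => ?_
      have h1 : ‖Complex.polarCoord.symm (r, θ)‖ = r := by
        rw [Complex.norm_polarCoord_symm, abs_of_pos hr]
      rw [h1]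
      congr 1
      rw [Complex.polarCoord_symm_apply, Complex.norm_def, Complex.normSq_apply]
      congr 1
      simp [-Complex.ofReal_cos, -Complex.ofReal_sin]
      linear_combination r ^ 2 * Real.sin_sq_add_cos_sq θ
    · refine hG.comp (f := fun θ => (_, _)) (Measurable.prodMk ?_ ?_) <;>
      · simp only [Complex.polarCoord_symm_apply]
        fun_prop
  · refine (Measurable.mul (by fun_prop) (hG.comp (f := fun p : ℝ × ℝ => (_, _))
      (Measurable.prodMk ?_ ?_))).aemeasurable <;>
    · simp only [Complex.polarCoord_symm_apply]
      fun_prop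

/-- For a node at `x ≠ 0` and a node spread over the annulus, the circle of radius `r` around `x`
contributes its radius times the angle under which it runs through the annulus. -/
lemma setLIntegral_annulus_dist {R₁ R₂ : ℝ} (hR₁ : 0 ≤ R₁) (hR₁₂ : R₁ ≤ R₂) {x : Plane}
    (hx : x ≠ 0) {h : ℝ → ENNReal} (hh : Measurable h) :
    ∫⁻ y in annulus R₁ R₂, h (dist x y) =
      ∫⁻ r in Set.Ioi (0 : ℝ), h r *
        ENNReal.ofReal (2 * r * (halfAngle R₂ ‖x‖ r - halfAngle R₁ ‖x‖ r)) := by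
  have hm : MeasurableSet (Set.Icc R₁ R₂) := measurableSet_Icc
  have hma : MeasurableSet (annulus R₁ R₂) := measurable_norm measurableSet_Icc
  have h1 : ∫⁻ y in annulus R₁ R₂, h (dist x y) =
      ∫⁻ y, (fun s r => (Set.Icc R₁ R₂).indicator (fun _ => h r) s) ‖y‖ (dist x y) := by
    rw [← lintegral_indicator hma]
    rfl
  have hG : Measurable
      (Function.uncurry fun s r : ℝ => (Set.Icc R₁ R₂).indicator (fun _ => h r) s) := by
    have : (Function.uncurry fun s r : ℝ => (Set.Icc R₁ R₂).indicator (fun _ => h r) s) =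
        (Prod.fst ⁻¹' Set.Icc R₁ R₂).indicator fun p => h p.2 := rfl
    rw [this]
    exact (hh.comp measurable_snd).indicator (measurable_fst hm)
  rw [h1, lintegral_norm_dist_eq_polar x hG]
  refine setLIntegral_congr_fun measurableSet_Ioi fun r hr => ?_
  have hr : 0 < r := hr
  have h2 : ∀ θ : ℝ,
      (Set.Icc R₁ R₂).indicator (fun _ => h r) (√(‖x‖ ^ 2 + r ^ 2 - 2 * r * ‖x‖ * Real.cos θ)) =
      {θ : ℝ | R₁ ^ 2 ≤ ‖x‖ ^ 2 + r ^ 2 - 2 * r * ‖x‖ * Real.cos θ ∧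
        ‖x‖ ^ 2 + r ^ 2 - 2 * r * ‖x‖ * Real.cos θ ≤ R₂ ^ 2}.indicator (fun _ => h r) θ := by
    intro θ
    have hnn : 0 ≤ ‖x‖ ^ 2 + r ^ 2 - 2 * r * ‖x‖ * Real.cos θ := by
      nlinarith [sq_nonneg (‖x‖ - r), Real.cos_le_one θ, mul_nonneg hr.le (norm_nonneg x)]
    simp only [Set.indicator_apply, Set.mem_Icc, Set.mem_ofPred_eq, Real.le_sqrt hR₁ hnn,
      Real.sqrt_le_left (hR₁.trans hR₁₂)]
  simp only [h2]
  have hms : MeasurableSet {θ : ℝ | R₁ ^ 2 ≤ ‖x‖ ^ 2 + r ^ 2 - 2 * r * ‖x‖ * Real.cos θ ∧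
        ‖x‖ ^ 2 + r ^ 2 - 2 * r * ‖x‖ * Real.cos θ ≤ R₂ ^ 2} :=
    MeasurableSet.inter (measurableSet_le (f := fun _ => R₁ ^ 2) (by fun_prop) (by fun_prop))
      (measurableSet_le (g := fun _ => R₂ ^ 2) (by fun_prop) (by fun_prop))
  rw [lintegral_indicator_const hms, Measure.restrict_apply hms,
    volume_angles_annulus hR₁ hR₁₂ (norm_pos_iff.2 hx) hr, mul_left_comm,
    ← ENNReal.ofReal_mul hr.le]
  congr 2
  ring

lemma lintegral_norm {h : ℝ → ENNReal} (hh : Measurable h) :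
    ∫⁻ y : Plane, h ‖y‖ = ∫⁻ r in Set.Ioi (0 : ℝ), h r * ENNReal.ofReal (2 * Real.pi * r) := by
  have := lintegral_norm_dist_eq_polar 0 (G := fun _ r => h r) (hh.comp measurable_snd)
  simp only [dist_zero_left] at this
  rw [this]
  refine setLIntegral_congr_fun measurableSet_Ioi fun r hr => ?_
  have hr : 0 < r := hr
  simp only [lintegral_const, MeasurableSet.univ, Measure.restrict_apply, Set.univ_inter,
    Real.volume_Ioo]
  rw [mul_left_comm, ← ENNReal.ofReal_mul hr.le]
  congr 2
  ring

/-! ### The closed form -/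

/-- The density of the distance of node 1 from the centre of the disk. -/
noncomputable def radialDensity (R₁ : ℝ) : Scenario → ℝ → ℝ
  | .s₁, ρ => if 0 ≤ ρ ∧ ρ ≤ R₁ then 2 * ρ / R₁ ^ 2 else 0
  | .s₂, ρ => rwpRadialDensity R₁ ρ

lemma radialDensity_nonneg (R₁ : ℝ) (s : Scenario) (ρ : ℝ) : 0 ≤ radialDensity R₁ s ρ := by
  cases s <;> simp only [radialDensity, rwpRadialDensity] <;> split_ifs with h
  · have := h.1
    positivity
  · rfl
  · have h0 := h.1
    have h1 : ρ ^ 2 / R₁ ^ 2 ≤ 1 := div_le_one_of_le₀ (pow_le_pow_left₀ h.1 h.2 2) (sq_nonneg _)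
    exact mul_nonneg (by positivity) (sub_nonneg.2 h1)
  · rfl

lemma measurable_radialDensity (R₁ : ℝ) (s : Scenario) : Measurable (radialDensity R₁ s) := by
  change Measurable fun ρ => radialDensity R₁ s ρ
  cases s <;> simp only [radialDensity, rwpRadialDensity] <;>
    exact Measurable.ite (measurableSet_Icc (a := 0) (b := R₁)) (by fun_prop) (by fun_prop)

lemma radialDensity_eq_zero {R₁ ρ : ℝ} (s : Scenario) (hρ : ρ ∉ Set.Icc 0 R₁) :
    radialDensity R₁ s ρ = 0 := by
  cases s <;> exact if_neg hρ

lemma continuousOn_radialDensity_mul {R₁ R₂ r : ℝ} (s : Scenario) (hr : 0 < r) :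
    ContinuousOn (fun ρ => radialDensity R₁ s ρ * (halfAngle R₂ ρ r - halfAngle R₁ ρ r))
      (Set.Icc 0 R₁) := by
  have hc : Continuous fun ρ => ρ * halfAngle R₂ ρ r - ρ * halfAngle R₁ ρ r :=
    (continuous_mul_halfAngle R₂ hr).sub (continuous_mul_halfAngle R₁ hr)
  cases s
  · refine (hc.const_mul (2 / R₁ ^ 2)).continuousOn.congr fun ρ hρ => ?_
    simp only [radialDensity, if_pos (show 0 ≤ ρ ∧ ρ ≤ R₁ from hρ)]
    ring
  · refine (Continuous.fun_mul (f := fun ρ => 4 / R₁ ^ 2 * (1 - ρ ^ 2 / R₁ ^ 2)) (by fun_prop)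
      hc).continuousOn.congr fun ρ hρ => ?_
    simp only [radialDensity, rwpRadialDensity, if_pos (show 0 ≤ ρ ∧ ρ ≤ R₁ from hρ)]
    ring

lemma k_self_eq {R r : ℝ} (hR : 0 < R) (hr : 0 < r) :
    k R R r = 2 * r * R * Real.sin (halfAngle R R r) := by
  rw [sin_halfAngle hR hr]
  field_simp

/-- The average over `ρ` is evaluated by the two moments of `halfAngle`. The formula holds
for every `r > 0`: outside its own range of `r` each angle takes an extreme value. -/
lemma integral_radialDensity_mul {R₁ R₂ r : ℝ} (hR₁ : 0 < R₁) (hR₂ : 0 < R₂) (hr : 0 < r)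
    (s : Scenario) :
    R₁ ^ 2 * ∫ ρ in (0)..R₁, radialDensity R₁ s ρ * (halfAngle R₂ ρ r - halfAngle R₁ ρ r) =
      q₃ R₁ r s * Real.sin (φ₀ R₁ r) + q₄ R₁ r s * φ₀ R₁ r
        + q₅ R₂ r s * Real.sin (φ₁ R₁ R₂ r) + q₆ R₁ R₂ r s * φ₁ R₁ R₂ r
        + q₇ R₁ s * φ₂ R₁ R₂ r + q₈ R₁ R₂ r s * k R₁ R₂ r := by
  have hφ₀ : φ₀ R₁ r = halfAngle R₁ R₁ r := rfl
  have hφ₁ : φ₁ R₁ R₂ r = halfAngle R₁ R₂ r := rfl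
  have hφ₂ : φ₂ R₁ R₂ r = halfAngle R₂ R₁ r := rfl
  have hc₁ := continuous_mul_halfAngle R₁ hr
  have hc₂ := continuous_mul_halfAngle R₂ hr
  have hi : ∀ {R}, Continuous (fun ρ => ρ * halfAngle R ρ r) →
      IntervalIntegrable (fun ρ => 2 * (ρ * halfAngle R ρ r)) volume 0 R₁ := fun h =>
    (h.const_mul 2).intervalIntegrable _ _
  have hi' : ∀ {R}, Continuous (fun ρ => ρ * halfAngle R ρ r) →
      IntervalIntegrable (fun ρ => 4 * (ρ ^ 2 * (ρ * halfAngle R ρ r))) volume 0 R₁ := fun h =>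
    (((continuous_pow 2).fun_mul h).const_mul 4).intervalIntegrable _ _
  have hmem : ∀ ρ ∈ Set.uIcc 0 R₁, 0 ≤ ρ ∧ ρ ≤ R₁ := fun ρ hρ => by
    rwa [Set.uIcc_of_le hR₁.le] at hρ
  rw [hφ₀, hφ₁, hφ₂]
  cases s
  · have h : ∫ ρ in (0)..R₁, radialDensity R₁ .s₁ ρ * (halfAngle R₂ ρ r - halfAngle R₁ ρ r) =
        ∫ ρ in (0)..R₁, 1 / R₁ ^ 2 *
          (2 * (ρ * halfAngle R₂ ρ r) - 2 * (ρ * halfAngle R₁ ρ r)) := by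
      refine intervalIntegral.integral_congr fun ρ hρ => ?_
      simp only [radialDensity, if_pos (hmem ρ hρ)]
      ring
    rw [h, intervalIntegral.integral_const_mul, intervalIntegral.integral_sub (hi hc₂) (hi hc₁),
      integral_mul_halfAngle hR₁ hr hR₁.le, integral_mul_halfAngle hR₂ hr hR₁.le,
      k_self_eq hR₁ hr, sin_halfAngle hR₂ hr, k_comm R₂ R₁]
    simp only [q₃, q₄, q₅, q₆, q₇, q₈]
    field_simp
    ring
  · have h : ∫ ρ in (0)..R₁, radialDensity R₁ .s₂ ρ * (halfAngle R₂ ρ r - halfAngle R₁ ρ r) =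
        ∫ ρ in (0)..R₁, (2 / R₁ ^ 2 *
          (2 * (ρ * halfAngle R₂ ρ r) - 2 * (ρ * halfAngle R₁ ρ r)) -
          1 / R₁ ^ 4 * (4 * (ρ ^ 2 * (ρ * halfAngle R₂ ρ r)) -
            4 * (ρ ^ 2 * (ρ * halfAngle R₁ ρ r)))) := by
      refine intervalIntegral.integral_congr fun ρ hρ => ?_
      simp only [radialDensity, rwpRadialDensity, if_pos (hmem ρ hρ)]
      field_simp
      ring
    rw [h, intervalIntegral.integral_sub (((hi hc₂).sub (hi hc₁)).const_mul _)
        (((hi' hc₂).sub (hi' hc₁)).const_mul _), intervalIntegral.integral_const_mul,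
      intervalIntegral.integral_const_mul, intervalIntegral.integral_sub (hi hc₂) (hi hc₁),
      intervalIntegral.integral_sub (hi' hc₂) (hi' hc₁),
      integral_mul_halfAngle hR₁ hr hR₁.le, integral_mul_halfAngle hR₂ hr hR₁.le,
      integral_cube_mul_halfAngle hR₁ hr hR₁.le, integral_cube_mul_halfAngle hR₂ hr hR₁.le,
      k_self_eq hR₁ hr, k_comm R₂ R₁]
    simp only [q₃, q₄, q₅, q₆, q₇, q₈]
    field_simp
    ring

lemma k_eq_zero {R ρ r : ℝ} (h : (r ^ 2 - (ρ - R) ^ 2) * ((R + ρ) ^ 2 - r ^ 2) ≤ 0) :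
    k R ρ r = 0 := Real.sqrt_eq_zero_of_nonpos h

lemma distanceDensity_of_nonpos {R₁ R₂ r : ℝ} (hR₁ : 0 < R₁) (hR₁₂ : R₁ < R₂) (s : Scenario)
    (hr : r ≤ 0) : distanceDensity R₁ R₂ s r = 0 := by
  rcases hr.eq_or_lt with rfl | hr
  · rw [distanceDensity, if_pos ⟨le_rfl, by linarith⟩]
    simp
  · rw [distanceDensity, if_neg (by intro h; linarith [h.1]),
      if_neg (by intro h; linarith [h.1]), if_neg (by intro h; linarith [h.1])]

lemma distanceDensity_eq_integral {R₁ R₂ r : ℝ} (hR₁ : 0 < R₁) (hR₁₂ : R₁ < R₂) (hr : 0 < r)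
    (s : Scenario) :
    distanceDensity R₁ R₂ s r = 2 * r / S R₁ R₂ *
      ∫ ρ in (0)..R₁, radialDensity R₁ s ρ * (halfAngle R₂ ρ r - halfAngle R₁ ρ r) := by
  have hR₂ : 0 < R₂ := hR₁.trans hR₁₂
  have hint := integral_radialDensity_mul (R₂ := R₂) hR₁ hR₂ hr s
  set I := ∫ ρ in (0)..R₁, radialDensity R₁ s ρ * (halfAngle R₂ ρ r - halfAngle R₁ ρ r)
  have hI : 2 * r / S R₁ R₂ * I = 2 * r / (S R₁ R₂ * R₁ ^ 2) * (R₁ ^ 2 * I) := by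
    rw [← div_div]
    field_simp
  rw [hI, hint, distanceDensity]
  split_ifs with h1 h2 h3
  · have hφ₁ : φ₁ R₁ R₂ r = 0 := halfAngle_eq_zero hR₂ hr (by nlinarith)
    have hφ₂ : φ₂ R₁ R₂ r = Real.pi := halfAngle_eq_pi hR₁ hr (by nlinarith)
    have hk : k R₁ R₂ r = 0 :=
      k_eq_zero (mul_nonpos_of_nonpos_of_nonneg (by nlinarith) (by nlinarith))
    have hq₃ : q₃ R₁ r s = R₁ * q₁ R₁ r s := by
      cases s <;> simp only [q₁, q₃] <;> field_simp
    have hq₄ : q₄ R₁ r s = R₁ * q₂ R₁ r s := by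
      cases s <;> simp only [q₂, q₄] <;> field_simp
    have hq₇ : q₇ R₁ s = R₁ ^ 2 := by cases s <;> rfl
    rw [hφ₁, hφ₂, hk, hq₃, hq₄, hq₇]
    simp only [Real.sin_zero, mul_zero, add_zero]
    rw [sq R₁, ← mul_assoc, ← div_div _ _ R₁]
    field_simp
    ring
  · rfl
  · have hφ₀ : φ₀ R₁ r = 0 := halfAngle_eq_zero hR₁ hr (by nlinarith)
    simp [hφ₀, q₉, q₁₀, q₁₁, q₁₂]
  · have hlt : R₁ + R₂ < r := by
      by_contra! hle
      by_cases h4 : r ≤ R₂ - R₁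
      · exact h1 ⟨hr.le, h4⟩
      · by_cases h5 : r ≤ 2 * R₁
        · exact h2 ⟨not_le.1 h4, h5⟩
        · exact h3 ⟨not_le.1 h5, hle⟩
    have hφ₀ : φ₀ R₁ r = 0 := halfAngle_eq_zero hR₁ hr (by nlinarith)
    have hφ₁ : φ₁ R₁ R₂ r = 0 := halfAngle_eq_zero hR₂ hr (by nlinarith)
    have hφ₂ : φ₂ R₁ R₂ r = 0 := halfAngle_eq_zero hR₁ hr (by nlinarith)
    have hk : k R₁ R₂ r = 0 :=
      k_eq_zero (mul_nonpos_of_nonneg_of_nonpos (by nlinarith) (by nlinarith))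
    simp [hφ₀, hφ₁, hφ₂, hk]

lemma S_pos {R₁ R₂ : ℝ} (hR₁ : 0 < R₁) (hR₁₂ : R₁ < R₂) : 0 < S R₁ R₂ :=
  mul_pos Real.pi_pos (by nlinarith)

lemma radialDensity_mul_nonneg {R₁ R₂ r : ℝ} (hR₁ : 0 < R₁) (hR₁₂ : R₁ < R₂) (hr : 0 < r)
    (s : Scenario) (ρ : ℝ) :
    0 ≤ radialDensity R₁ s ρ * (halfAngle R₂ ρ r - halfAngle R₁ ρ r) := by
  by_cases hρ : ρ ∈ Set.Icc 0 R₁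
  · exact mul_nonneg (radialDensity_nonneg _ _ _)
      (sub_nonneg.2 (halfAngle_mono hR₁.le hR₁₂.le hρ.1 hr.le))
  · simp [radialDensity_eq_zero s hρ]

lemma distanceDensity_nonneg {R₁ R₂ : ℝ} (hR₁ : 0 < R₁) (hR₁₂ : R₁ < R₂) (s : Scenario) (r : ℝ) :
    0 ≤ distanceDensity R₁ R₂ s r := by
  rcases le_or_gt r 0 with hr | hr
  · rw [distanceDensity_of_nonpos hR₁ hR₁₂ s hr]
  · rw [distanceDensity_eq_integral hR₁ hR₁₂ hr]
    have := S_pos hR₁ hR₁₂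
    exact mul_nonneg (by positivity) (intervalIntegral.integral_nonneg hR₁.le
      fun ρ _ => radialDensity_mul_nonneg hR₁ hR₁₂ hr s ρ)

lemma ofReal_distanceDensity {R₁ R₂ r : ℝ} (hR₁ : 0 < R₁) (hR₁₂ : R₁ < R₂) (hr : 0 < r)
    (s : Scenario) :
    ENNReal.ofReal (distanceDensity R₁ R₂ s r) = ENNReal.ofReal (2 * r / S R₁ R₂) *
      ∫⁻ ρ, ENNReal.ofReal (radialDensity R₁ s ρ * (halfAngle R₂ ρ r - halfAngle R₁ ρ r)) := by
  have hS := S_pos hR₁ hR₁₂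
  rw [distanceDensity_eq_integral hR₁ hR₁₂ hr, ENNReal.ofReal_mul (by positivity),
    intervalIntegral.integral_of_le hR₁.le, ← integral_Icc_eq_integral_Ioc,
    ofReal_integral_eq_lintegral_ofReal
      ((continuousOn_radialDensity_mul s hr).integrableOn_compact isCompact_Icc)
      (ae_of_all _ (radialDensity_mul_nonneg hR₁ hR₁₂ hr s)),
    setLIntegral_eq_of_support_subset]
  intro ρ hρ
  contrapose! hρ
  simp [radialDensity_eq_zero s hρ]

lemma measurable_distanceDensity (R₁ R₂ : ℝ) (s : Scenario) :
    Measurable (distanceDensity R₁ R₂ s) := by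
  have harccos := Real.continuous_arccos.measurable
  have h₀ : Measurable (φ₀ R₁) := by
    unfold φ₀ θ₁
    exact harccos.comp (by fun_prop)
  have h₁ : Measurable (φ₁ R₁ R₂) := by
    unfold φ₁ θ₁
    exact harccos.comp (by fun_prop)
  have h₂ : Measurable (φ₂ R₁ R₂) := by
    unfold φ₂ θ₂
    exact harccos.comp (by fun_prop)
  have hk : Measurable (k R₁ R₂) := by
    unfold k
    fun_prop
  unfold distanceDensity
  refine Measurable.ite measurableSet_Icc ?_ (Measurable.ite measurableSet_Ioc ?_
    (Measurable.ite measurableSet_Ioc ?_ measurable_const)) <;>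
  cases s <;>
  simp only [q₁, q₂, q₃, q₄, q₅, q₆, q₇, q₈, q₉, q₁₀, q₁₁, q₁₂] <;>
  fun_prop

/-! ### The law of the distance -/

lemma volume_closedBall_plane {R : ℝ} (hR : 0 ≤ R) :
    volume (Metric.closedBall (0 : Plane) R) = ENNReal.ofReal (Real.pi * R ^ 2) := by
  rw [InnerProductSpace.volume_closedBall_of_dim_even (k := 1) (by simp), mul_comm Real.pi,
    ENNReal.ofReal_mul (by positivity), ENNReal.ofReal_pow hR]
  simp

lemma disk_eq_closedBall (R : ℝ) : disk R = Metric.closedBall 0 R := by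
  ext
  simp [disk]

lemma volume_annulus {R₁ R₂ : ℝ} (hR₁ : 0 ≤ R₁) (hR₁₂ : R₁ ≤ R₂) :
    volume (annulus R₁ R₂) = ENNReal.ofReal (S R₁ R₂) := by
  have h : annulus R₁ R₂ = Metric.closedBall 0 R₂ \ Metric.ball 0 R₁ := by
    ext
    simp [annulus, and_comm]
  rw [h, measure_sdiff (Metric.ball_subset_closedBall.trans (Metric.closedBall_subset_closedBall
    hR₁₂)) measurableSet_ball.nullMeasurableSet measure_ball_lt_top.ne,
    ← Measure.addHaar_closedBall_eq_addHaar_ball, volume_closedBall_plane hR₁,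
    volume_closedBall_plane (hR₁.trans hR₁₂), ← ENNReal.ofReal_sub _ (by positivity), S, mul_sub]

/-- Both scenarios prescribe the law of the distance of node 1 from the centre, which is all that
the law of the distance between the nodes depends on. -/
lemma map_norm_eq_withDensity {Ω : Type*} [MeasurableSpace Ω] {P : Measure Ω}
    {R₁ : ℝ} (hR₁ : 0 < R₁) {s : Scenario} {X₁ : Ω → Plane} (hX₁ : AEMeasurable X₁ P)
    (hlaw : Node1Law P X₁ R₁ s) :
    (P.map X₁).map (‖·‖) = volume.withDensity fun ρ => ENNReal.ofReal (radialDensity R₁ s ρ) := by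
  cases s
  · have hlaw : P.map X₁ = (volume (disk R₁))⁻¹ • volume.restrict (disk R₁) := hlaw
    have hd : MeasurableSet (disk R₁) := by
      rw [disk_eq_closedBall]
      exact measurableSet_closedBall
    refine Measure.ext_of_lintegral _ fun h hh => ?_
    have hf := (measurable_radialDensity R₁ .s₁).ennreal_ofReal
    rw [lintegral_map hh measurable_norm, hlaw, lintegral_smul_measure,
      lintegral_withDensity_eq_lintegral_mul _ hf hh, ← lintegral_indicator hd,
      disk_eq_closedBall, volume_closedBall_plane hR₁.le, smul_eq_mul]
    have h1 : ∀ x : Plane, (Metric.closedBall 0 R₁).indicator (fun a : Plane => h ‖a‖) x =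
        (Set.Iic R₁).indicator h ‖x‖ := fun x => by
      by_cases hx : ‖x‖ ≤ R₁ <;> simp [hx]
    simp only [h1]
    rw [lintegral_norm (hh.indicator measurableSet_Iic), ← lintegral_const_mul' _ _ (by
      simpa using by positivity), ← lintegral_indicator measurableSet_Ioi]
    refine lintegral_congr fun ρ => ?_
    simp only [Pi.mul_apply, radialDensity, Set.indicator_apply, Set.mem_Ioi, Set.mem_Iic]
    rcases lt_trichotomy ρ 0 with hρ | rfl | hρ
    · simp [hρ.not_gt, hρ.not_ge]
    · simp
    · by_cases hle : ρ ≤ R₁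
      · simp only [hρ, hle, hρ.le, and_self, if_true]
        rw [← ENNReal.ofReal_inv_of_pos (by positivity), mul_left_comm,
          ← ENNReal.ofReal_mul (by positivity), mul_comm]
        congr 2
        field_simp
      · simp [hle]
  · obtain ⟨hpdf, -, hae⟩ := hlaw
    rw [AEMeasurable.map_map_of_aemeasurable measurable_norm.aemeasurable hX₁]
    exact (map_eq_withDensity_pdf (fun ω => ‖X₁ ω‖) P volume).trans (withDensity_congr_ae hae)

lemma map_dist_eq_withDensity {Ω : Type*} [MeasurableSpace Ω] {P : Measure Ω}
    [IsProbabilityMeasure P] {R₁ R₂ : ℝ} (hR₁ : 0 < R₁) (hR₁₂ : R₁ < R₂) {s : Scenario}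
    {X₁ X₂ : Ω → Plane} (hX₁ : AEMeasurable X₁ P) (hX₂ : AEMeasurable X₂ P)
    (hindep : IndepFun X₁ X₂ P) (hlaw₁ : Node1Law P X₁ R₁ s)
    (hlaw₂ : pdf.IsUniform X₂ (annulus R₁ R₂) P volume) :
    P.map (fun ω => dist (X₁ ω) (X₂ ω)) =
      volume.withDensity fun r => ENNReal.ofReal (distanceDensity R₁ R₂ s r) := by
  have hS := S_pos hR₁ hR₁₂
  have hnorm := map_norm_eq_withDensity hR₁ hX₁ hlaw₁
  have hf := (measurable_radialDensity R₁ s).ennreal_ofReal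
  -- The junk value of `halfAngle` at `ρ = 0` is harmless, as node 1 is not at the centre.
  have hne : ∀ᵐ x ∂(P.map X₁), x ≠ 0 := by
    have h0 : ∀ᵐ ρ ∂((P.map X₁).map (‖·‖)), ρ ≠ 0 := by
      rw [hnorm]
      exact (withDensity_absolutelyContinuous _ _).ae_le
        ((Set.countable_singleton (0 : ℝ)).ae_notMem volume)
    filter_upwards [ae_of_ae_map measurable_norm.aemeasurable h0] with x hx
    exact norm_ne_zero_iff.1 hx
  have hangle : ∀ R : ℝ, Measurable fun p : ℝ × ℝ => halfAngle R p.1 p.2 := fun R => by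
    unfold halfAngle
    exact Real.continuous_arccos.measurable.comp (by fun_prop)
  have hW : Measurable fun p : ℝ × ℝ =>
      ENNReal.ofReal (2 * p.2 * (halfAngle R₂ p.1 p.2 - halfAngle R₁ p.1 p.2)) :=
    ((measurable_snd.const_mul 2).mul ((hangle R₂).sub (hangle R₁))).ennreal_ofReal
  have hdist : AEMeasurable (fun ω => dist (X₁ ω) (X₂ ω)) P := hX₁.dist hX₂
  refine Measure.ext_of_lintegral _ fun h hh => ?_
  have hhd : Measurable fun p : Plane × Plane => h (dist p.1 p.2) := hh.comp measurable_dist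
  have hhW : Measurable fun p : ℝ × ℝ =>
      h p.2 * ENNReal.ofReal (2 * p.2 * (halfAngle R₂ p.1 p.2 - halfAngle R₁ p.1 p.2)) :=
    (hh.comp measurable_snd).mul hW
  have hinner : Measurable fun ρ : ℝ => ∫⁻ r in Set.Ioi (0 : ℝ),
      h r * ENNReal.ofReal (2 * r * (halfAngle R₂ ρ r - halfAngle R₁ ρ r)) :=
    Measurable.lintegral_prod_right' (ν := volume.restrict (Set.Ioi (0 : ℝ))) hhW
  calc ∫⁻ r, h r ∂(P.map fun ω => dist (X₁ ω) (X₂ ω))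
      = ∫⁻ p, h (dist p.1 p.2) ∂(P.map fun ω => (X₁ ω, X₂ ω)) := by
        rw [lintegral_map' hh.aemeasurable hdist,
          lintegral_map' hhd.aemeasurable (hX₁.prodMk hX₂)]
    _ = ∫⁻ x, ∫⁻ y, h (dist x y) ∂(P.map X₂) ∂(P.map X₁) := by
        have := Measure.isProbabilityMeasure_map hX₂
        rw [(indepFun_iff_map_prod_eq_prod_map_map hX₁ hX₂).1 hindep,
          lintegral_prod _ hhd.aemeasurable]
    _ = ∫⁻ x, (ENNReal.ofReal (S R₁ R₂))⁻¹ * (∫⁻ r in Set.Ioi (0 : ℝ), h r *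
          ENNReal.ofReal (2 * r * (halfAngle R₂ ‖x‖ r - halfAngle R₁ ‖x‖ r))) ∂(P.map X₁) := by
        refine lintegral_congr_ae ?_
        filter_upwards [hne] with x hx
        have hlaw₂ : P.map X₂ =
          (volume (annulus R₁ R₂))⁻¹ • volume.restrict (annulus R₁ R₂) := hlaw₂
        rw [hlaw₂, lintegral_smul_measure, smul_eq_mul, volume_annulus hR₁.le hR₁₂.le,
          setLIntegral_annulus_dist hR₁.le hR₁₂.le hx hh]
    _ = ∫⁻ ρ, ENNReal.ofReal (radialDensity R₁ s ρ) * ((ENNReal.ofReal (S R₁ R₂))⁻¹ *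
          ∫⁻ r in Set.Ioi (0 : ℝ), h r *
            ENNReal.ofReal (2 * r * (halfAngle R₂ ρ r - halfAngle R₁ ρ r))) := by
        rw [← lintegral_map (g := fun x : Plane => ‖x‖) (hinner.const_mul _) measurable_norm,
          hnorm, lintegral_withDensity_eq_lintegral_mul _ hf (hinner.const_mul _)]
        rfl
    _ = ∫⁻ ρ, ∫⁻ r in Set.Ioi (0 : ℝ), ENNReal.ofReal (radialDensity R₁ s ρ) *
          ((ENNReal.ofReal (S R₁ R₂))⁻¹ * (h r *
            ENNReal.ofReal (2 * r * (halfAngle R₂ ρ r - halfAngle R₁ ρ r)))) := by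
        refine lintegral_congr fun ρ => ?_
        rw [lintegral_const_mul' _ _ ENNReal.ofReal_ne_top,
          lintegral_const_mul' _ _ (by simpa using hS)]
    _ = ∫⁻ r in Set.Ioi (0 : ℝ), ∫⁻ ρ, ENNReal.ofReal (radialDensity R₁ s ρ) *
          ((ENNReal.ofReal (S R₁ R₂))⁻¹ * (h r *
            ENNReal.ofReal (2 * r * (halfAngle R₂ ρ r - halfAngle R₁ ρ r)))) :=
        lintegral_lintegral_swap ((hf.comp measurable_fst).mul (hhW.const_mul _)).aemeasurable
    _ = ∫⁻ r in Set.Ioi (0 : ℝ), ENNReal.ofReal (distanceDensity R₁ R₂ s r) * h r := by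
        refine setLIntegral_congr_fun measurableSet_Ioi fun r hr => ?_
        have hr : 0 < r := hr
        rw [ofReal_distanceDensity hR₁ hR₁₂ hr, mul_right_comm, ← lintegral_const_mul]
        · refine lintegral_congr fun ρ => ?_
          rw [ENNReal.ofReal_mul (radialDensity_nonneg R₁ s ρ), ENNReal.ofReal_mul (by positivity),
            ENNReal.ofReal_div_of_pos hS, div_eq_mul_inv]
          ring
        · exact ((measurable_radialDensity R₁ s).mul
            (((hangle R₂).sub (hangle R₁)).comp measurable_prodMk_right)).ennreal_ofReal
    _ = ∫⁻ r, ENNReal.ofReal (distanceDensity R₁ R₂ s r) * h r := by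
        rw [← lintegral_indicator measurableSet_Ioi]
        refine lintegral_congr fun r => ?_
        by_cases hr : 0 < r
        · simp [hr]
        · simp [hr, distanceDensity_of_nonpos hR₁ hR₁₂ s (not_lt.1 hr)]
    _ = ∫⁻ r, h r ∂(volume.withDensity
          fun r => ENNReal.ofReal (distanceDensity R₁ R₂ s r)) := by
        rw [lintegral_withDensity_eq_lintegral_mul _
          (measurable_distanceDensity R₁ R₂ s).ennreal_ofReal hh]
        rfl

end DiskAnnulus

theorem theorem1 {Ω : Type*} [MeasurableSpace Ω] (P : Measure Ω) [IsProbabilityMeasure P]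
    (R₁ R₂ : ℝ) (hR₁ : 0 < R₁) (hR₁₂ : R₁ < R₂) (hR₂ : R₂ ≤ 3 * R₁)
    (s : DiskAnnulus.Scenario)
    (X₁ X₂ : Ω → DiskAnnulus.Plane) (hX₁ : AEMeasurable X₁ P) (hX₂ : AEMeasurable X₂ P)
    (hindep : IndepFun X₁ X₂ P)
    (hlaw₁ : DiskAnnulus.Node1Law P X₁ R₁ s)
    (hlaw₂ : pdf.IsUniform X₂ (DiskAnnulus.annulus R₁ R₂) P volume) :
    DiskAnnulus.HasDensity P (fun ω => dist (X₁ ω) (X₂ ω))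
      (DiskAnnulus.distanceDensity R₁ R₂ s) := by
  have hm := (DiskAnnulus.measurable_distanceDensity R₁ R₂ s).ennreal_ofReal.aemeasurable
    (μ := volume)
  have hmap := DiskAnnulus.map_dist_eq_withDensity hR₁ hR₁₂ hX₁ hX₂ hindep hlaw₁ hlaw₂
  have hpdf := hasPDF_of_map_eq_withDensity (hX₁.dist hX₂) _ hm hmap
  exact ⟨hpdf, DiskAnnulus.distanceDensity_nonneg hR₁ hR₁₂ s,
    (pdf.eq_of_map_eq_withDensity _ hm).1 hmap⟩
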